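/- Let $x_0$ be a random vector in $\mathbb{R}^d$ whose law has a smooth ($C^\infty$) density $p$. For $t\in(0,1]$ let $x_t = s_t x_0+\sigma_t\varepsilon_t$, where $\varepsilon_t\sim\mathcal N(0,I)$ is independent of $x_0$, $s_t>0$ and $\sigma_t>0$, with $s_t\to s_0>0$ and $\sigma_t\to0$ as $t\to0^+$. Let $C:\mathbb{R}^d\to\mathbb{R}^r$ be real analytic on $\mathbb{R}^d$. For $t\in(0,1]$ and $x\in\mathbb{R}^d$ let $p(x_0\mid x_t=x)$ denote the probability measure given by Bayes' formula, i.e. with density proportional to $z\mapsto p(z)\exp\!\big(-\|x-s_tz\|^2/(2\sigma_t^2)\big)$. Let $\hat x_0=\mathbb{E}[x_0\mid x_t=x]$ and $\hat\Sigma=\mathrm{Cov}[x_0\mid x_t=x]$ be its mean and covariance, and let $\nabla C$ denote the $d\times r$ matrix $(\partial C_j/\partial x_i)_{i,j}$ evaluated at $\hat x_0$. Then, for every $t\in(0,1]$, $p(x_0\mid x_t=\cdot)$ is a version of the conditional law of $x_0$ given $x_t$, and it has finite second moments for every value $x$. Moreover, let $x_*\in\mathbb{R}^d$ be a point with $p(x_*)>0$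 at which the Jacobian of $C$ has rank $r$, and let $(x(t))_{t>0}$ be any family of points with $x(t)\to s_0x_*$ as $t\to0^+$ (for instance the constant family $x(t)=s_0x_*$). Then, conditioning on $x_t=x(t)$, the matrix $\nabla C^\top\hat\Sigma\,\nabla C$ is positive definite for all sufficiently small $t>0$, and $$\big(\nabla C^\top\hat\Sigma\,\nabla C\big)^{-1/2}\big(C(x_0)-C(\hat x_0)\big)\ \longrightarrow_d\ \mathcal N(0,I_r)\qquad (t\to0^+),$$ where $x_0\sim p(x_0\mid x_t=x(t))$. In this sense the combined linearization and moment-matching approximation $p(C(x_0)\mid x_t)\approx\mathcal N\big(C(\hat x_0),\nabla C^\top\hat\Sigma\,\nabla C\big)$ becomes exact as the noise vanishes. -/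

import Mathlib

open MeasureTheory ProbabilityTheory Filter Topology
open scoped ContDiff Matrix

noncomputable section

/-- The conditional law `p(x₀ | x_t = x)` in the noise model `x_t = s x₀ + σ ε`, `ε ∼ N(0, I)`,
with prior `x₀ ∼ μ₀`, as given by Bayes' formula: its density with respect to `μ₀` is
`z ↦ exp (-‖x - s z‖² / (2σ²)) / ∫ exp (-‖x - s w‖² / (2σ²)) dμ₀(w)`
(the normalizing constant of the Gaussian density of `x_t | x₀ = z` cancels). -/
def posteriorLaw {d : ℕ} (μ₀ : Measure (EuclideanSpace ℝ (Fin d))) (s σ : ℝ)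
    (x : EuclideanSpace ℝ (Fin d)) : Measure (EuclideanSpace ℝ (Fin d)) :=
  μ₀.tilted fun z => -‖x - s • z‖ ^ 2 / (2 * σ ^ 2)

instance isProbabilityMeasure_posteriorLaw {d : ℕ} (μ₀ : Measure (EuclideanSpace ℝ (Fin d)))
    [IsProbabilityMeasure μ₀] (s σ : ℝ) (x : EuclideanSpace ℝ (Fin d)) :
    IsProbabilityMeasure (posteriorLaw μ₀ s σ x) := by
  refine isProbabilityMeasure_tilted (Integrable.of_bound (C := 1) ?_ (ae_of_all _ fun z => ?_))
  · exact Continuous.aestronglyMeasurable (by fun_prop)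
  · rw [Real.norm_eq_abs, Real.abs_exp, Real.exp_le_one_iff, neg_div, neg_nonpos]
    positivity

/-- The conditional mean `x̂₀ = E[x₀ | x_t = x]`. -/
def posteriorMean {d : ℕ} (μ₀ : Measure (EuclideanSpace ℝ (Fin d))) (s σ : ℝ)
    (x : EuclideanSpace ℝ (Fin d)) : EuclideanSpace ℝ (Fin d) :=
  ∫ z, z ∂(posteriorLaw μ₀ s σ x)

/-- The conditional covariance matrix `Σ̂ = Cov[x₀ | x_t = x]`. -/
def posteriorCov {d : ℕ} (μ₀ : Measure (EuclideanSpace ℝ (Fin d))) (s σ : ℝ)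
    (x : EuclideanSpace ℝ (Fin d)) : Matrix (Fin d) (Fin d) ℝ :=
  Matrix.of fun i j => cov[fun z => z i, fun z => z j; posteriorLaw μ₀ s σ x]

/-- The `d × r` matrix `∇C(x)` with entries `∂C_j / ∂x_i`. -/
def gradMatrix {d r : ℕ} (C : EuclideanSpace ℝ (Fin d) → EuclideanSpace ℝ (Fin r))
    (x : EuclideanSpace ℝ (Fin d)) : Matrix (Fin d) (Fin r) ℝ :=
  Matrix.of fun i j => (fderiv ℝ C x (EuclideanSpace.single i 1)) j

/-- The covariance `∇Cᵀ Σ̂ ∇C` of the linearized moment-matching approximation, with `∇C`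
evaluated at the linearization point `x̂₀`. -/
def linearizedCov {d r : ℕ} (μ₀ : Measure (EuclideanSpace ℝ (Fin d)))
    (C : EuclideanSpace ℝ (Fin d) → EuclideanSpace ℝ (Fin r)) (s σ : ℝ)
    (x : EuclideanSpace ℝ (Fin d)) : Matrix (Fin r) (Fin r) ℝ :=
  (gradMatrix C (posteriorMean μ₀ s σ x))ᵀ * posteriorCov μ₀ s σ x *
    gradMatrix C (posteriorMean μ₀ s σ x)

/-- `M ^ (-1/2)` for a symmetric positive definite matrix `M`, through the spectral calculus. -/
def invSqrt {r : ℕ} (M : Matrix (Fin r) (Fin r) ℝ) : Matrix (Fin r) (Fin r) ℝ :=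
  cfc (fun a : ℝ => (√a)⁻¹) M

/-- The standardized residual `(∇Cᵀ Σ̂ ∇C) ^ (-1/2) (C(z) - C(x̂₀))`, as a function of the value
`z` of `x₀`. -/
def standardizedResidual {d r : ℕ} (μ₀ : Measure (EuclideanSpace ℝ (Fin d)))
    (C : EuclideanSpace ℝ (Fin d) → EuclideanSpace ℝ (Fin r)) (s σ : ℝ)
    (x z : EuclideanSpace ℝ (Fin d)) : EuclideanSpace ℝ (Fin r) :=
  Matrix.toEuclideanLin (invSqrt (linearizedCov μ₀ C s σ x)) (C z - C (posteriorMean μ₀ s σ x))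

end

/-!
# Exactness of linearized moment matching for vanishing noise

Write `m = s⁻¹ x`, `τ = σ / s` and `z = m + τ u`. In the coordinate `u` the posterior law of `x₀` has
density proportional to `p (m + τ u) exp (-‖u‖² / 2)`. As the noise vanishes, `τ → 0` and `m → x⋆`,
so by Laplace's method (`tendsto_integral_laplace`) posterior expectations of functions of `u` of at
most quadratic growth converge to standard Gaussian expectations
(`tendsto_integral_posteriorLaw`). The density `p` is only known to be continuous and integrable, so
dominated convergence applies near `x⋆`, and away from `x⋆` the Gaussian factor
`exp (-δ² / (4 τ²))` absorbs the Jacobian `τ ^ (-d)`.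

Taking first and second moments, the posterior mean is `m + o(τ)` and the posterior covariance is
`τ² (1 + o(1))`. With `J` the gradient matrix at `x⋆`, `τ⁻² ∇Cᵀ Σ̂ ∇C` then converges to `Jᵀ J`,
which is positive definite by the rank condition. By strict differentiability of `C` and continuity of
the inverse square root on positive definite matrices, the standardized residual converges pointwise
in `u` to `(Jᵀ J) ^ (-1/2) Jᵀ u` (`tendsto_standardizedResidual`). This linear map `L` satisfies
`L Lᵀ = 1`, so it sends the standard Gaussian measure of the domain to that of the target, which gives
the limit law when bounded continuous functions of the residual are inserted in the Laplace
asymptotics.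

That `posteriorLaw` is the conditional law is Bayes' formula: the joint law of the observation and
of `x₀` disintegrates along the posterior laws (`map_observation_eq_compProd`).
-/

/-! ### The standard Gaussian measure -/

lemma integrable_exp_neg_norm_sq {E : Type*} [NormedAddCommGroup E] [InnerProductSpace ℝ E]
    [FiniteDimensional ℝ E] [MeasurableSpace E] [BorelSpace E] {b : ℝ} (hb : 0 < b) :
    Integrable (fun v : E => Real.exp (-b * ‖v‖ ^ 2)) := by
  have h := (GaussianFourier.integrable_cexp_neg_mul_sq_norm_add
    (V := E) (b := (b : ℂ)) (by simpa using hb) 0 0).norm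
  refine h.congr (ae_of_all _ fun v => ?_)
  simp only [Complex.norm_exp]
  congr 1
  norm_cast
  simp

/-- The standard Gaussian measure has Lebesgue density proportional to `exp (-‖v‖² / 2)`: both
measures have the characteristic function `exp (-‖t‖² / 2)`. -/
lemma stdGaussian_eq_tilted (E : Type*) [NormedAddCommGroup E] [InnerProductSpace ℝ E]
    [FiniteDimensional ℝ E] [MeasurableSpace E] [BorelSpace E] :
    stdGaussian E = (volume : Measure E).tilted fun v => -‖v‖ ^ 2 / 2 := by
  have hfun : (fun v : E => Real.exp (-‖v‖ ^ 2 / 2))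
      = fun v : E => Real.exp (-(1 / 2 : ℝ) * ‖v‖ ^ 2) := by
    ext v; congr 1; ring
  have hint : Integrable (fun v : E => Real.exp (-‖v‖ ^ 2 / 2)) := by
    rw [hfun]; exact integrable_exp_neg_norm_sq (by norm_num)
  have := isProbabilityMeasure_tilted hint
  refine Measure.ext_of_charFun (funext fun t => ?_)
  rw [charFun_stdGaussian, charFun_apply, integral_tilted]
  have hre : 0 < ((1 / 2 : ℂ)).re := by norm_num
  have h1 := GaussianFourier.integral_cexp_neg_mul_sq_norm_add (V := E) hre Complex.I t
  have h0 : ((∫ v : E, Real.exp (-‖v‖ ^ 2 / 2) : ℝ) : ℂ)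
      = (Real.pi / (1 / 2 : ℂ)) ^ (Module.finrank ℝ E / 2 : ℂ) := by
    rw [← GaussianFourier.integral_cexp_neg_mul_sq_norm hre, ← integral_complex_ofReal]
    congr 1; ext v; push_cast; congr 1; ring
  have hne : ((∫ v : E, Real.exp (-‖v‖ ^ 2 / 2) : ℝ) : ℂ) ≠ 0 := by
    exact_mod_cast (integral_exp_pos hint).ne'
  have h2 : ∀ v : E, (Real.exp (-‖v‖ ^ 2 / 2) / ∫ v : E, Real.exp (-‖v‖ ^ 2 / 2)) •
      Complex.exp (inner ℝ v t * Complex.I)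
      = ((∫ v : E, Real.exp (-‖v‖ ^ 2 / 2) : ℝ) : ℂ)⁻¹ *
        Complex.exp (-(1 / 2 : ℂ) * ‖v‖ ^ 2 + Complex.I * inner ℝ t v) := by
    intro v
    rw [Complex.real_smul, Complex.exp_add, real_inner_comm]
    push_cast
    rw [div_eq_inv_mul, mul_assoc]
    congr 3
    · ring
    · rw [mul_comm]
  simp_rw [h2]
  rw [integral_const_mul, h1, ← h0, inv_mul_cancel_left₀ hne, Complex.I_sq]
  congr 1; ring

lemma integral_stdGaussian {E G : Type*} [NormedAddCommGroup E] [InnerProductSpace ℝ E]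
    [FiniteDimensional ℝ E] [MeasurableSpace E] [BorelSpace E] [NormedAddCommGroup G]
    [NormedSpace ℝ G] (F : E → G) :
    ∫ v, F v ∂(stdGaussian E) = (∫ v : E, Real.exp (-‖v‖ ^ 2 / 2))⁻¹ •
      ∫ v, Real.exp (-‖v‖ ^ 2 / 2) • F v := by
  rw [stdGaussian_eq_tilted, integral_tilted, ← integral_smul]
  simp_rw [div_eq_inv_mul _ (∫ v : E, Real.exp (-‖v‖ ^ 2 / 2)), mul_smul]

/-- A linear map `L` with `L L† = 1` maps the standard Gaussian measure to the standard Gaussian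
measure. -/
lemma stdGaussian_map_of_comp_adjoint_eq_id {E F : Type*} [NormedAddCommGroup E]
    [InnerProductSpace ℝ E] [FiniteDimensional ℝ E] [MeasurableSpace E] [BorelSpace E]
    [NormedAddCommGroup F] [InnerProductSpace ℝ F] [FiniteDimensional ℝ F] [MeasurableSpace F]
    [BorelSpace F] (L : E →ₗ[ℝ] F) (hL : L ∘ₗ LinearMap.adjoint L = LinearMap.id) :
    (stdGaussian E).map L = stdGaussian F := by
  have hLc : Continuous L := L.continuous_of_finiteDimensional
  have : IsProbabilityMeasure ((stdGaussian E).map L) :=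
    Measure.isProbabilityMeasure_map (by fun_prop)
  have hnorm : ∀ t, ‖LinearMap.adjoint L t‖ ^ 2 = ‖t‖ ^ 2 := fun t => by
    rw [← real_inner_self_eq_norm_sq, ← real_inner_self_eq_norm_sq, LinearMap.adjoint_inner_left,
      ← LinearMap.comp_apply, hL, LinearMap.id_apply]
  refine Measure.ext_of_charFun (funext fun t => ?_)
  rw [charFun_stdGaussian, charFun_apply, integral_map (by fun_prop)
    (Continuous.aestronglyMeasurable (by fun_prop)), ← Complex.ofReal_pow, ← hnorm t,
    Complex.ofReal_pow, ← charFun_stdGaussian, charFun_apply]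
  simp_rw [LinearMap.adjoint_inner_right]

/-! ### The inverse square root of a positive definite matrix -/

section InvSqrt

variable {r : ℕ} {A : Matrix (Fin r) (Fin r) ℝ}

lemma continuousOn_spectrum_matrix (f : ℝ → ℝ) : ContinuousOn f (spectrum ℝ A) :=
  Matrix.finite_real_spectrum.continuousOn f

lemma spectrum_subset_Ioi_of_posDef (hA : A.PosDef) : spectrum ℝ A ⊆ Set.Ioi 0 := by
  rw [hA.isHermitian.spectrum_real_eq_range_eigenvalues]
  rintro _ ⟨i, rfl⟩
  exact hA.eigenvalues_pos i

open scoped Matrix.Norms.L2Operator in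
/-- The `L²` operator norm makes the functional calculus isometric, and it induces the topology of
entrywise convergence. -/
lemma continuousOn_invSqrt :
    ContinuousOn (invSqrt (r := r)) {A | A.PosDef} := by
  refine ContinuousOn.cfc_of_mem_nhdsSet (s := Set.Ioi (0 : ℝ)) (fun a : ℝ => (√a)⁻¹)
    (a := id) ?_ continuousOn_id (fun A hA => Matrix.PosDef.isHermitian hA) ?_
  · rw [isOpen_Ioi.mem_nhdsSet]
    exact Set.iUnion₂_subset fun A hA => spectrum_subset_Ioi_of_posDef hA
  · exact fun a ha => (Real.continuous_sqrt.continuousAt.inv₀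
      (Real.sqrt_ne_zero'.2 ha)).continuousWithinAt

lemma invSqrt_smul (hA : A.IsHermitian) {c : ℝ} (hc : 0 ≤ c) :
    invSqrt (c • A) = (√c)⁻¹ • invSqrt A := by
  have hA' : IsSelfAdjoint A := hA
  unfold invSqrt
  rw [← cfc_comp_smul c _ A ((Matrix.finite_real_spectrum.image _).continuousOn _) hA',
    ← cfc_smul _ _ _ (continuousOn_spectrum_matrix _)]
  congr 1
  ext a
  simp [Real.sqrt_mul hc, mul_comm]

lemma isHermitian_invSqrt : (invSqrt A).IsHermitian :=
  cfc_predicate (p := IsSelfAdjoint) _ A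

lemma invSqrt_mul_self_mul_invSqrt (hA : A.PosDef) : invSqrt A * A * invSqrt A = 1 := by
  have hA' : IsSelfAdjoint A := hA.isHermitian
  have h : ∀ f : ℝ → ℝ, ContinuousOn f (spectrum ℝ A) := continuousOn_spectrum_matrix
  unfold invSqrt
  nth_rw 2 [← cfc_id ℝ A]
  rw [← cfc_mul _ _ _ (h _) (h _), ← cfc_mul _ _ _ (h _) (h _), ← cfc_one ℝ A]
  refine cfc_congr fun a ha => ?_
  have ha : 0 < a := spectrum_subset_Ioi_of_posDef hA ha
  have := Real.sqrt_pos.2 ha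
  simp only [id, Pi.one_apply]
  field_simp
  exact (Real.sq_sqrt ha.le).symm

end InvSqrt

/-! ### The Bayes formula -/

lemma lintegral_comp_add_smul {E : Type*} [NormedAddCommGroup E] [NormedSpace ℝ E]
    [MeasurableSpace E] [BorelSpace E] [FiniteDimensional ℝ E] (μ : Measure E)
    [μ.IsAddHaarMeasure] {f : E → ENNReal} (hf : Measurable f) (a : E) {τ : ℝ} (hτ : τ ≠ 0) :
    ∫⁻ u, f (a + τ • u) ∂μ =
      ENNReal.ofReal |(τ ^ Module.finrank ℝ E)⁻¹| * ∫⁻ y, f y ∂μ := by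
  rw [← lintegral_add_left_eq_self (μ := μ) f a, ← smul_eq_mul, ← lintegral_smul_measure,
    ← Measure.map_addHaar_smul μ hτ, lintegral_map (by fun_prop) (by fun_prop)]

section Bayes

variable {d : ℕ} (μ₀ : Measure (EuclideanSpace ℝ (Fin d))) [IsProbabilityMeasure μ₀]

lemma integrable_likelihood (s σ : ℝ) (x : EuclideanSpace ℝ (Fin d)) :
    Integrable (fun z => Real.exp (-‖x - s • z‖ ^ 2 / (2 * σ ^ 2))) μ₀ := by
  refine Integrable.of_bound (C := 1) ?_ (ae_of_all _ fun z => ?_)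
  · exact Continuous.aestronglyMeasurable (by fun_prop)
  · rw [Real.norm_eq_abs, Real.abs_exp, Real.exp_le_one_iff, neg_div, neg_nonpos]
    positivity

lemma measurable_bayesDensity (s σ : ℝ) :
    Measurable (Function.uncurry fun x z : EuclideanSpace ℝ (Fin d) =>
      ENNReal.ofReal (Real.exp (-‖x - s • z‖ ^ 2 / (2 * σ ^ 2)) /
        ∫ w, Real.exp (-‖x - s • w‖ ^ 2 / (2 * σ ^ 2)) ∂μ₀)) := by
  have h : Measurable fun q : EuclideanSpace ℝ (Fin d) × EuclideanSpace ℝ (Fin d) =>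
      Real.exp (-‖q.1 - s • q.2‖ ^ 2 / (2 * σ ^ 2)) := by fun_prop
  have h' := (h.stronglyMeasurable.integral_prod_right' (ν := μ₀)).measurable
  exact (h.div (h'.comp measurable_fst)).ennreal_ofReal

/-- The posterior laws, as a Markov kernel from observations to values of `x₀`. -/
noncomputable def posteriorKernel (s σ : ℝ) :
    Kernel (EuclideanSpace ℝ (Fin d)) (EuclideanSpace ℝ (Fin d)) :=
  (Kernel.const _ μ₀).withDensity fun x z =>
    ENNReal.ofReal (Real.exp (-‖x - s • z‖ ^ 2 / (2 * σ ^ 2)) /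
      ∫ w, Real.exp (-‖x - s • w‖ ^ 2 / (2 * σ ^ 2)) ∂μ₀)

lemma posteriorKernel_apply (s σ : ℝ) (x : EuclideanSpace ℝ (Fin d)) :
    posteriorKernel μ₀ s σ x = posteriorLaw μ₀ s σ x := by
  rw [posteriorKernel, Kernel.withDensity_apply _ (measurable_bayesDensity μ₀ s σ),
    Kernel.const_apply]
  rfl

instance isMarkovKernel_posteriorKernel (s σ : ℝ) : IsMarkovKernel (posteriorKernel μ₀ s σ) :=
  ⟨fun x => by rw [posteriorKernel_apply]; infer_instance⟩

/-- The joint law of the observation `s x₀ + σ ε` and of `x₀` disintegrates along the posterior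
laws. -/
lemma map_observation_eq_compProd {s σ : ℝ} (hσ : σ ≠ 0) :
    ∃ q : Measure (EuclideanSpace ℝ (Fin d)), SFinite q ∧
      (μ₀.prod (stdGaussian (EuclideanSpace ℝ (Fin d)))).map
        (fun a => (s • a.1 + σ • a.2, a.1)) = q ⊗ₘ posteriorKernel μ₀ s σ := by
  set E := EuclideanSpace ℝ (Fin d)
  set Z : E → ℝ := fun x => ∫ w, Real.exp (-‖x - s • w‖ ^ 2 / (2 * σ ^ 2)) ∂μ₀
  set c : ℝ := ∫ v : E, Real.exp (-‖v‖ ^ 2 / 2)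
  have hc : 0 ≤ c := integral_nonneg fun _ => (Real.exp_pos _).le
  have hZ : ∀ x, 0 < Z x := fun x => integral_exp_pos (integrable_likelihood μ₀ s σ x)
  set k : ENNReal := ENNReal.ofReal |(σ ^ Module.finrank ℝ E)⁻¹| with hk
  have hmE : Measurable fun q : E × E => Real.exp (-‖q.1 - s • q.2‖ ^ 2 / (2 * σ ^ 2)) := by
    fun_prop
  have hZm : Measurable Z := (hmE.stronglyMeasurable.integral_prod_right' (ν := μ₀)).measurable
  -- the density of the observation
  have hρ : Measurable fun y => k * ENNReal.ofReal (Z y / c) := by fun_prop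
  refine ⟨volume.withDensity fun y => k * ENNReal.ofReal (Z y / c), inferInstance,
    Measure.ext_of_lintegral _ fun f hf => ?_⟩
  rw [lintegral_map hf (by fun_prop), lintegral_prod _ (by fun_prop), Measure.lintegral_compProd hf,
    lintegral_withDensity_eq_lintegral_mul _ hρ (by fun_prop)]
  have hR : ∀ y, ((fun y => k * ENNReal.ofReal (Z y / c)) * fun y =>
      ∫⁻ z, f (y, z) ∂posteriorKernel μ₀ s σ y) y
      = ∫⁻ z, k * (ENNReal.ofReal (Real.exp (-‖y - s • z‖ ^ 2 / (2 * σ ^ 2)) / c) * f (y, z))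
        ∂μ₀ := by
    intro y
    rw [Pi.mul_apply, posteriorKernel_apply, posteriorLaw, lintegral_tilted,
      ← lintegral_const_mul _ (by fun_prop)]
    refine lintegral_congr fun z => ?_
    rw [mul_assoc, ← mul_assoc (ENNReal.ofReal (Z y / c)), ← ENNReal.ofReal_mul
      (div_nonneg (hZ y).le hc)]
    congr 3
    have := (hZ y).ne'
    change Z y / c * (_ / Z y) = _
    field_simp
  have hL : ∀ z, ∫⁻ e, f (s • z + σ • e, z) ∂(stdGaussian E)
      = ∫⁻ y, k * (ENNReal.ofReal (Real.exp (-‖y - s • z‖ ^ 2 / (2 * σ ^ 2)) / c) * f (y, z)) := by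
    intro z
    rw [stdGaussian_eq_tilted, lintegral_tilted, lintegral_const_mul _ (by fun_prop), hk,
      ← lintegral_comp_add_smul volume (by fun_prop) (s • z) hσ]
    refine lintegral_congr fun u => ?_
    congr 4
    rw [add_sub_cancel_left, norm_smul, mul_pow, Real.norm_eq_abs, sq_abs]
    field_simp
  rw [lintegral_congr hL, lintegral_congr hR]
  exact lintegral_lintegral_swap (by fun_prop)

/-- Bayes' formula: the posterior law is a version of the conditional law. -/
lemma condDistrib_ae_eq_posteriorLaw {Ω : Type*} [MeasurableSpace Ω] {P : Measure Ω}
    [IsProbabilityMeasure P] {s σ : ℝ} (hσ : σ ≠ 0) {X₀ ε X : Ω → EuclideanSpace ℝ (Fin d)}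
    (hX₀ : HasLaw X₀ μ₀ P) (hε : HasLaw ε (stdGaussian (EuclideanSpace ℝ (Fin d))) P)
    (hind : IndepFun X₀ ε P) (hX : ∀ w, X w = s • X₀ w + σ • ε w) :
    ∀ᵐ y ∂(P.map X), condDistrib X₀ X P y = posteriorLaw μ₀ s σ y := by
  obtain ⟨q, _, hq⟩ := map_observation_eq_compProd μ₀ (s := s) hσ
  have hX₀m := hX₀.aemeasurable
  have hεm := hε.aemeasurable
  obtain rfl : X = fun w => s • X₀ w + σ • ε w := funext hX
  have hXm : AEMeasurable (fun w => s • X₀ w + σ • ε w) P := by fun_prop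
  have hjoint : P.map (fun w => (s • X₀ w + σ • ε w, X₀ w)) = q ⊗ₘ posteriorKernel μ₀ s σ := by
    rw [← hq, ← hX₀.map_eq, ← hε.map_eq,
      ← (indepFun_iff_map_prod_eq_prod_map_map hX₀m hεm).1 hind,
      AEMeasurable.map_map_of_aemeasurable (by fun_prop) (by fun_prop)]
    rfl
  have hmarg : P.map (fun w => s • X₀ w + σ • ε w) = q := by
    rw [← Measure.fst_compProd q (posteriorKernel μ₀ s σ), ← hjoint, Measure.fst,
      AEMeasurable.map_map_of_aemeasurable (by fun_prop) (by fun_prop)]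
    rfl
  have h := condDistrib_ae_eq_of_measure_eq_compProd (μ := P) (fun w => s • X₀ w + σ • ε w) hX₀m
    (κ := posteriorKernel μ₀ s σ) (by rw [hmarg, hjoint])
  filter_upwards [h] with y hy
  rw [hy, posteriorKernel_apply]

/-- The posterior law has finite second moments whatever the prior, since
`‖z‖² exp (-‖x - s z‖² / (2σ²))` is bounded in `z`. -/
lemma memLp_id_posteriorLaw {s σ : ℝ} (hs : s ≠ 0) (hσ : σ ≠ 0) (x : EuclideanSpace ℝ (Fin d)) :
    MemLp id 2 (posteriorLaw μ₀ s σ x) := by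
  rw [memLp_two_iff_integrable_sq_norm (by fun_prop), posteriorLaw,
    integrable_tilted_iff (integrable_likelihood μ₀ s σ x)]
  refine Integrable.of_bound (C := (2 * ‖x‖ ^ 2 + 4 * σ ^ 2) / s ^ 2)
    (Continuous.aestronglyMeasurable (by fun_prop)) (ae_of_all _ fun z => ?_)
  have hs2 : 0 < s ^ 2 := by positivity
  have hσ2 : 0 < 2 * σ ^ 2 := by positivity
  rw [smul_eq_mul, norm_mul, Real.norm_eq_abs, Real.abs_exp, norm_pow, norm_norm, id,
    le_div_iff₀ hs2]
  set w := ‖x - s • z‖ with hw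
  have h1 : s ^ 2 * ‖z‖ ^ 2 ≤ 2 * ‖x‖ ^ 2 + 2 * w ^ 2 := by
    have : ‖s • z‖ ≤ ‖x‖ + w := by
      rw [← norm_neg (s • z)]
      calc ‖-(s • z)‖ = ‖(x - s • z) - x‖ := by congr 1; abel
        _ ≤ _ := by rw [add_comm]; exact norm_sub_le _ _
    have h2 := pow_le_pow_left₀ (norm_nonneg _) this 2
    rw [norm_smul, mul_pow, Real.norm_eq_abs, sq_abs] at h2
    nlinarith [sq_nonneg (‖x‖ - w)]
  have h3 : w ^ 2 / (2 * σ ^ 2) * Real.exp (-w ^ 2 / (2 * σ ^ 2)) ≤ 1 := by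
    rw [neg_div, Real.exp_neg, ← div_eq_mul_inv, div_le_one (Real.exp_pos _)]
    linarith [Real.add_one_le_exp (w ^ 2 / (2 * σ ^ 2))]
  have h4 : w ^ 2 * Real.exp (-w ^ 2 / (2 * σ ^ 2)) ≤ 2 * σ ^ 2 := by
    rw [div_mul_eq_mul_div, div_le_one hσ2] at h3
    exact h3
  have h5 : Real.exp (-w ^ 2 / (2 * σ ^ 2)) ≤ 1 := by
    rw [Real.exp_le_one_iff, neg_div, neg_nonpos]; positivity
  calc Real.exp (-w ^ 2 / (2 * σ ^ 2)) * ‖z‖ ^ 2 * s ^ 2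
      = Real.exp (-w ^ 2 / (2 * σ ^ 2)) * (s ^ 2 * ‖z‖ ^ 2) := by ring
    _ ≤ Real.exp (-w ^ 2 / (2 * σ ^ 2)) * (2 * ‖x‖ ^ 2 + 2 * w ^ 2) := by gcongr
    _ = Real.exp (-w ^ 2 / (2 * σ ^ 2)) * (2 * ‖x‖ ^ 2)
        + 2 * (w ^ 2 * Real.exp (-w ^ 2 / (2 * σ ^ 2))) := by ring
    _ ≤ 1 * (2 * ‖x‖ ^ 2) + 2 * (2 * σ ^ 2) := by gcongr
    _ = _ := by ring

end Bayes

/-! ### Laplace asymptotics -/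

section Laplace

variable {E G : Type*} [NormedAddCommGroup E] [InnerProductSpace ℝ E]
    [FiniteDimensional ℝ E] [MeasurableSpace E] [BorelSpace E] [NormedAddCommGroup G]
    [NormedSpace ℝ G]

lemma integral_comp_add_smul (f : E → G) (a : E) (τ : ℝ) :
    ∫ u, f (a + τ • u) = |(τ ^ Module.finrank ℝ E)⁻¹| • ∫ z, f z := by
  rw [← integral_add_left_eq_self f a, ← Measure.integral_comp_smul]

/-- Half of the Gaussian exponent absorbs a quadratic factor. -/
lemma one_add_sq_mul_exp_le (y : ℝ) :
    Real.exp (-y ^ 2 / 2) * (1 + y ^ 2) ≤ 4 * Real.exp (-y ^ 2 / 4) := by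
  have h1 : 1 + y ^ 2 ≤ 4 * Real.exp (y ^ 2 / 4) := by
    nlinarith [Real.add_one_le_exp (y ^ 2 / 4), sq_nonneg y]
  calc Real.exp (-y ^ 2 / 2) * (1 + y ^ 2)
      ≤ Real.exp (-y ^ 2 / 2) * (4 * Real.exp (y ^ 2 / 4)) := by gcongr
    _ = 4 * (Real.exp (-y ^ 2 / 2) * Real.exp (y ^ 2 / 4)) := by ring
    _ = _ := by rw [← Real.exp_add]; congr 2; ring

lemma integrable_exp_mul_one_add_sq :
    Integrable fun u : E => Real.exp (-‖u‖ ^ 2 / 2) * (1 + ‖u‖ ^ 2) := by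
  refine ((integrable_exp_neg_norm_sq (E := E) (b := 1 / 4) (by norm_num)).const_mul 4).mono'
    (Continuous.aestronglyMeasurable (by fun_prop)) (ae_of_all _ fun u => ?_)
  rw [Real.norm_of_nonneg (by positivity)]
  refine (one_add_sq_mul_exp_le _).trans_eq ?_
  congr 2; ring

/-- Gaussian decay in `1 / τ` beats every power of `τ`. -/
lemma tendsto_inv_pow_mul_exp {ι : Type*} {l : Filter ι} {τ : ι → ℝ}
    (hτ : Tendsto τ l (𝓝[>] 0)) (n : ℕ) {c : ℝ} (hc : 0 < c) :
    Tendsto (fun t => |(τ t ^ n)⁻¹| * Real.exp (-(c / τ t ^ 2))) l (𝓝 0) := by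
  have h := (tendsto_rpow_abs_mul_exp_neg_mul_sq_cocompact hc n).comp
    (atTop_le_cocompact (α := ℝ))
  refine (h.comp (tendsto_inv_nhdsGT_zero.comp hτ)).congr fun t => ?_
  simp only [Function.comp_apply, Real.rpow_natCast]
  rw [← abs_pow, inv_pow, neg_mul, inv_pow, div_eq_mul_inv]

/-- Laplace's method: as `τ → 0` and `m → x`, the weight `p (m + τ u)` may be replaced by `p x`
in integrals against a Gaussian weight. Near `x` the density `p` is bounded and dominated
convergence applies. Away from `x` only the integrability of `p` is available, and the Gaussian
weight beats the Jacobian `τ ^ (-d)` of the substitution `z = m + τ u`. -/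
lemma tendsto_integral_laplace {ι : Type*} {l : Filter ι} [l.IsCountablyGenerated]
    {p : E → ℝ} (hp : Continuous p) (hp0 : ∀ z, 0 ≤ p z) (hpi : Integrable p)
    {x : E} {m : ι → E} (hm : Tendsto m l (𝓝 x)) {τ : ι → ℝ} (hτ : Tendsto τ l (𝓝[>] 0))
    {F : ι → E → G} {f : E → G} {K : ℝ}
    (hFm : ∀ t, AEStronglyMeasurable (F t) volume)
    (hFb : ∀ᶠ t in l, ∀ u, ‖F t u‖ ≤ K * (1 + ‖u‖ ^ 2))
    (hF : ∀ u, Tendsto (fun t => F t u) l (𝓝 (f u))) :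
    Tendsto (fun t => ∫ u, (p (m t + τ t • u) * Real.exp (-‖u‖ ^ 2 / 2)) • F t u) l
      (𝓝 (∫ u, (p x * Real.exp (-‖u‖ ^ 2 / 2)) • f u)) := by
  obtain ⟨δ, hδ, hpb⟩ : ∃ δ > 0, ∀ z, dist z x < 2 * δ → p z ≤ p x + 1 := by
    obtain ⟨r, hr, h⟩ := Metric.eventually_nhds_iff.1
      (hp.continuousAt.eventually (ge_mem_nhds (lt_add_one (p x))) : ∀ᶠ z in 𝓝 x, p z ≤ p x + 1)
    exact ⟨r / 2, by positivity, fun z hz => h (by linarith)⟩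
  have hτ0 : Tendsto τ l (𝓝 0) := hτ.mono_right nhdsWithin_le_nhds
  have hτpos : ∀ᶠ t in l, 0 < τ t := hτ.eventually self_mem_nhdsWithin
  have hmδ : ∀ᶠ t in l, dist (m t) x < δ := hm.eventually (Metric.ball_mem_nhds x hδ)
  set W : ι → E → G := fun t u => (p (m t + τ t • u) * Real.exp (-‖u‖ ^ 2 / 2)) • F t u with hW
  have hWm : ∀ t, AEStronglyMeasurable (W t) volume := fun t =>
    (Continuous.aestronglyMeasurable (by fun_prop)).smul (hFm t)
  have hWb : ∀ᶠ t in l, ∀ u, ‖W t u‖ ≤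
      p (m t + τ t • u) * (K * (Real.exp (-‖u‖ ^ 2 / 2) * (1 + ‖u‖ ^ 2))) := by
    filter_upwards [hFb] with t ht u
    have := hp0 (m t + τ t • u)
    rw [hW, norm_smul, Real.norm_of_nonneg (by positivity)]
    calc _ ≤ p (m t + τ t • u) * Real.exp (-‖u‖ ^ 2 / 2) * (K * (1 + ‖u‖ ^ 2)) := by
          gcongr; exact ht u
      _ = _ := by ring
  -- `S t` is the set of `u` for which `m t + τ t • u` lies within `δ` of `m t`
  set S : ι → Set E := fun t => {u | ‖τ t • u‖ < δ}
  have hS : ∀ t, MeasurableSet (S t) := fun t =>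
    measurableSet_lt (by fun_prop) measurable_const
  have hK : ∀ᶠ t in l, 0 ≤ K := by
    filter_upwards [hFb] with t ht
    simpa using (norm_nonneg _).trans (ht 0)
  have hBi : Integrable fun u : E =>
      (p x + 1) * (K * (Real.exp (-‖u‖ ^ 2 / 2) * (1 + ‖u‖ ^ 2))) :=
    (integrable_exp_mul_one_add_sq.const_mul K).const_mul _
  have hnear_le : ∀ᶠ t in l, ∀ u, ‖(S t).indicator (W t) u‖ ≤
      (p x + 1) * (K * (Real.exp (-‖u‖ ^ 2 / 2) * (1 + ‖u‖ ^ 2))) := by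
    filter_upwards [hWb, hmδ, hK] with t ht hmt hK u
    have := hp0 x
    by_cases hu : u ∈ S t
    · rw [Set.indicator_of_mem hu]
      refine (ht u).trans ?_
      gcongr
      refine hpb _ ?_
      have hu' : ‖τ t • u‖ < δ := hu
      calc dist (m t + τ t • u) x ≤ dist (m t + τ t • u) (m t) + dist (m t) x :=
            dist_triangle _ _ _
        _ < δ + δ := by
            gcongr
            rwa [dist_eq_norm, add_sub_cancel_left]
        _ = _ := by ring
    · rw [Set.indicator_of_notMem hu, norm_zero]
      positivity
  have hnear : Tendsto (fun t => ∫ u, (S t).indicator (W t) u) l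
      (𝓝 (∫ u, (p x * Real.exp (-‖u‖ ^ 2 / 2)) • f u)) := by
    refine tendsto_integral_filter_of_dominated_convergence _
      (Eventually.of_forall fun t => (hWm t).indicator (hS t))
      (hnear_le.mono fun t ht => ae_of_all _ ht) hBi (ae_of_all _ fun u => ?_)
    have h1 : Tendsto (fun t => τ t • u) l (𝓝 0) := by simpa using hτ0.smul_const u
    have h2 : Tendsto (fun t => m t + τ t • u) l (𝓝 x) := by simpa using hm.add h1
    have h3 : Tendsto (fun t => W t u) l (𝓝 ((p x * Real.exp (-‖u‖ ^ 2 / 2)) • f u)) :=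
      (((hp.tendsto x).comp h2).mul_const _).smul (hF u)
    refine h3.congr' ?_
    have h4 : ∀ᶠ t in l, ‖τ t • u‖ < δ :=
      h1.norm.eventually (gt_mem_nhds (by simpa using hδ))
    filter_upwards [h4] with t ht
    exact (Set.indicator_of_mem (s := S t) ht _).symm
  -- on the complement of `S t` the Gaussian factor is at most `exp (-δ² / (4 τ²))`
  have hfar_le : ∀ᶠ t in l, ∀ u, ‖(S t)ᶜ.indicator (W t) u‖ ≤
      K * 4 * Real.exp (-(δ ^ 2 / 4 / τ t ^ 2)) * p (m t + τ t • u) := by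
    filter_upwards [hWb, hτpos, hK] with t ht hτt hK u
    have hpu := hp0 (m t + τ t • u)
    by_cases hu : u ∈ (S t)ᶜ
    · rw [Set.indicator_of_mem hu]
      have hu' : δ ≤ τ t * ‖u‖ := by
        have : ¬ ‖τ t • u‖ < δ := hu
        rw [norm_smul, Real.norm_of_nonneg hτt.le] at this
        exact not_lt.1 this
      have hu2 : Real.exp (-‖u‖ ^ 2 / 4) ≤ Real.exp (-(δ ^ 2 / 4 / τ t ^ 2)) := by
        rw [Real.exp_le_exp, neg_div, neg_le_neg_iff, div_le_iff₀ (by positivity)]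
        have := pow_le_pow_left₀ hδ.le hu' 2
        rw [mul_pow] at this
        linarith
      calc _ ≤ _ := ht u
        _ ≤ p (m t + τ t • u) * (K * (4 * Real.exp (-(δ ^ 2 / 4 / τ t ^ 2)))) := by
            refine mul_le_mul_of_nonneg_left (mul_le_mul_of_nonneg_left ?_ hK) hpu
            exact (one_add_sq_mul_exp_le _).trans (by gcongr)
        _ = _ := by ring
    · rw [Set.indicator_of_notMem hu, norm_zero]
      positivity
  have hpτ : ∀ᶠ t in l, Integrable fun u => p (m t + τ t • u) := by
    filter_upwards [hτpos] with t ht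
    exact (hpi.comp_add_left (m t)).comp_smul ht.ne'
  have hfar : Tendsto (fun t => ∫ u, (S t)ᶜ.indicator (W t) u) l (𝓝 0) := by
    have hlim := (tendsto_inv_pow_mul_exp hτ (Module.finrank ℝ E)
      (c := δ ^ 2 / 4) (by positivity)).const_mul (K * 4 * ∫ z, p z)
    rw [mul_zero] at hlim
    refine squeeze_zero_norm' ?_ hlim
    filter_upwards [hfar_le, hpτ] with t ht hpt
    refine (norm_integral_le_of_norm_le (hpt.const_mul _) (ae_of_all _ ht)).trans_eq ?_
    rw [integral_const_mul, integral_comp_add_smul, smul_eq_mul]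
    ring
  rw [← add_zero (∫ u, (p x * Real.exp (-‖u‖ ^ 2 / 2)) • f u)]
  refine (hnear.add hfar).congr' ?_
  filter_upwards [hnear_le, hfar_le, hpτ] with t h1 h2 hpt
  rw [← integral_add
    (hBi.mono' ((hWm t).indicator (hS t)) (ae_of_all _ h1))
    ((hpt.const_mul _).mono' ((hWm t).indicator (hS t).compl) (ae_of_all _ h2))]
  simp_rw [Set.indicator_self_add_compl_apply]
  rfl

end Laplace

/-! ### Posterior expectations in the limit of vanishing noise -/

section Posterior

variable {d : ℕ} {p : EuclideanSpace ℝ (Fin d) → ℝ} {μ₀ : Measure (EuclideanSpace ℝ (Fin d))}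

/-- In the coordinate `u` given by `z = s⁻¹ x + (σ / s) u`, the likelihood becomes
`exp (-‖u‖² / 2)`. -/
lemma integral_likelihood_smul {G : Type*} [NormedAddCommGroup G] [NormedSpace ℝ G]
    (hp : Continuous p) (hp0 : ∀ z, 0 ≤ p z)
    (hμ₀ : μ₀ = volume.withDensity fun z => ENNReal.ofReal (p z)) {s σ : ℝ} (hs : s ≠ 0)
    (hσ : σ ≠ 0) (x : EuclideanSpace ℝ (Fin d)) (g : EuclideanSpace ℝ (Fin d) → G) :
    ∫ u, (p (s⁻¹ • x + (σ / s) • u) * Real.exp (-‖u‖ ^ 2 / 2)) • g (s⁻¹ • x + (σ / s) • u) =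
      |((σ / s) ^ Module.finrank ℝ (EuclideanSpace ℝ (Fin d)))⁻¹| •
        ∫ z, Real.exp (-‖x - s • z‖ ^ 2 / (2 * σ ^ 2)) • g z ∂μ₀ := by
  have hu : ∀ u, Real.exp (-‖u‖ ^ 2 / 2) =
      Real.exp (-‖x - s • (s⁻¹ • x + (σ / s) • u)‖ ^ 2 / (2 * σ ^ 2)) := by
    intro u
    have : x - s • (s⁻¹ • x + (σ / s) • u) = -(σ • u) := by
      rw [smul_add, smul_smul, smul_smul, mul_inv_cancel₀ hs, mul_div_cancel₀ _ hs, one_smul]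
      abel
    rw [this, norm_neg, norm_smul, mul_pow, Real.norm_eq_abs, sq_abs]
    congr 1
    field_simp
  rw [hμ₀, integral_withDensity_eq_integral_toReal_smul (by fun_prop) (by simp),
    ← integral_comp_add_smul _ (s⁻¹ • x)]
  simp_rw [hu, ENNReal.toReal_ofReal (hp0 _), smul_smul]

/-- The posterior expectation in the coordinate `u` given by `z = s⁻¹ x + (σ / s) u`. -/
lemma integral_posteriorLaw {G : Type*} [NormedAddCommGroup G] [NormedSpace ℝ G]
    (hp : Continuous p) (hp0 : ∀ z, 0 ≤ p z)
    (hμ₀ : μ₀ = volume.withDensity fun z => ENNReal.ofReal (p z)) {s σ : ℝ} (hs : s ≠ 0)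
    (hσ : σ ≠ 0) (x : EuclideanSpace ℝ (Fin d)) (g : EuclideanSpace ℝ (Fin d) → G) :
    ∫ z, g z ∂(posteriorLaw μ₀ s σ x) =
      (∫ u, p (s⁻¹ • x + (σ / s) • u) * Real.exp (-‖u‖ ^ 2 / 2))⁻¹ •
        ∫ u, (p (s⁻¹ • x + (σ / s) • u) * Real.exp (-‖u‖ ^ 2 / 2)) •
          g (s⁻¹ • x + (σ / s) • u) := by
  have h1 := integral_likelihood_smul hp hp0 hμ₀ hs hσ x fun _ => (1 : ℝ)
  simp only [smul_eq_mul, mul_one] at h1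
  rw [h1, integral_likelihood_smul hp hp0 hμ₀ hs hσ x g, posteriorLaw, integral_tilted, mul_inv,
    smul_smul, mul_right_comm, inv_mul_cancel₀ (by positivity), one_mul, ← integral_smul]
  simp_rw [div_eq_inv_mul (Real.exp _), mul_smul]

variable [IsProbabilityMeasure μ₀]

lemma integrable_density (hp : Continuous p) (hp0 : ∀ z, 0 ≤ p z)
    (hμ₀ : μ₀ = volume.withDensity fun z => ENNReal.ofReal (p z)) : Integrable p := by
  refine ⟨hp.aestronglyMeasurable, ?_⟩
  rw [hasFiniteIntegral_iff_ofReal (ae_of_all _ hp0), ← setLIntegral_univ,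
    ← withDensity_apply _ MeasurableSet.univ, ← hμ₀]
  exact measure_lt_top _ _

variable {ι : Type*} {l : Filter ι} [l.IsCountablyGenerated] {s σ : ι → ℝ}
  {x : ι → EuclideanSpace ℝ (Fin d)} {xstar : EuclideanSpace ℝ (Fin d)}

/-- Posterior expectations converge to standard Gaussian expectations of the pointwise limit in the
coordinate `u = (σ / s)⁻¹ (z - s⁻¹ x)`. -/
lemma tendsto_integral_posteriorLaw {G : Type*} [NormedAddCommGroup G] [NormedSpace ℝ G]
    (hp : Continuous p) (hp0 : ∀ z, 0 ≤ p z)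
    (hμ₀ : μ₀ = volume.withDensity fun z => ENNReal.ofReal (p z)) (hpx : 0 < p xstar)
    (hs : ∀ᶠ t in l, 0 < s t) (hσ : ∀ᶠ t in l, 0 < σ t)
    (hm : Tendsto (fun t => (s t)⁻¹ • x t) l (𝓝 xstar))
    (hτ : Tendsto (fun t => σ t / s t) l (𝓝 0))
    {g : ι → EuclideanSpace ℝ (Fin d) → G} {f : EuclideanSpace ℝ (Fin d) → G} {K : ℝ}
    (hgc : ∀ t, Continuous (g t))
    (hgb : ∀ᶠ t in l, ∀ u, ‖g t ((s t)⁻¹ • x t + (σ t / s t) • u)‖ ≤ K * (1 + ‖u‖ ^ 2))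
    (hg : ∀ u, Tendsto (fun t => g t ((s t)⁻¹ • x t + (σ t / s t) • u)) l (𝓝 (f u))) :
    Tendsto (fun t => ∫ z, g t z ∂(posteriorLaw μ₀ (s t) (σ t) (x t))) l
      (𝓝 (∫ u, f u ∂(stdGaussian (EuclideanSpace ℝ (Fin d))))) := by
  have hpi := integrable_density hp hp0 hμ₀
  have hτ' : Tendsto (fun t => σ t / s t) l (𝓝[>] 0) := by
    refine tendsto_nhdsWithin_iff.2 ⟨hτ, ?_⟩
    filter_upwards [hs, hσ] with t h1 h2 using div_pos h2 h1
  have hnum := tendsto_integral_laplace hp hp0 hpi hm hτ'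
    (F := fun t u => g t ((s t)⁻¹ • x t + (σ t / s t) • u)) (f := f) (K := K)
    (fun t => ((hgc t).comp (by fun_prop)).aestronglyMeasurable) hgb hg
  have hden := tendsto_integral_laplace hp hp0 hpi hm hτ'
    (F := fun _ _ => (1 : ℝ)) (f := fun _ => (1 : ℝ)) (K := 1)
    (fun t => aestronglyMeasurable_const)
    (Eventually.of_forall fun t u => by rw [norm_one]; nlinarith [sq_nonneg ‖u‖])
    (fun u => tendsto_const_nhds)
  simp only [smul_eq_mul, mul_one] at hden
  have hne : ∫ u : EuclideanSpace ℝ (Fin d), p xstar * Real.exp (-‖u‖ ^ 2 / 2) ≠ 0 := by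
    rw [integral_const_mul]
    refine mul_ne_zero hpx.ne' (integral_exp_pos ?_).ne'
    refine (integrable_exp_neg_norm_sq (b := 1 / 2) (by norm_num)).congr (ae_of_all _ fun u => ?_)
    ring_nf
  have hlim : ∫ u, f u ∂(stdGaussian (EuclideanSpace ℝ (Fin d))) =
      (∫ u : EuclideanSpace ℝ (Fin d), p xstar * Real.exp (-‖u‖ ^ 2 / 2))⁻¹ •
        ∫ u, (p xstar * Real.exp (-‖u‖ ^ 2 / 2)) • f u := by
    simp_rw [mul_smul]
    rw [integral_stdGaussian, integral_const_mul, integral_smul, smul_smul, mul_inv, mul_assoc,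
      mul_comm _ (p xstar), ← mul_assoc, inv_mul_cancel₀ hpx.ne', one_mul]
  rw [hlim]
  refine ((hden.inv₀ hne).smul hnum).congr' ?_
  filter_upwards [hs, hσ] with t h1 h2
  exact (integral_posteriorLaw hp hp0 hμ₀ h1.ne' h2.ne' _ _).symm

/-- The posterior mean deviates from `s⁻¹ x` by `o(σ / s)`. -/
lemma tendsto_posteriorMean_sub (hp : Continuous p) (hp0 : ∀ z, 0 ≤ p z)
    (hμ₀ : μ₀ = volume.withDensity fun z => ENNReal.ofReal (p z)) (hpx : 0 < p xstar)
    (hs : ∀ᶠ t in l, 0 < s t) (hσ : ∀ᶠ t in l, 0 < σ t)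
    (hm : Tendsto (fun t => (s t)⁻¹ • x t) l (𝓝 xstar))
    (hτ : Tendsto (fun t => σ t / s t) l (𝓝 0)) :
    Tendsto (fun t => (σ t / s t)⁻¹ • (posteriorMean μ₀ (s t) (σ t) (x t) - (s t)⁻¹ • x t)) l
      (𝓝 0) := by
  have hu : ∀ᶠ t in l, ∀ u, (σ t / s t)⁻¹ • (((s t)⁻¹ • x t + (σ t / s t) • u) - (s t)⁻¹ • x t)
      = u := by
    filter_upwards [hs, hσ] with t h1 h2 u
    rw [add_sub_cancel_left, inv_smul_smul₀ (div_pos h2 h1).ne']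
  rw [← integral_id_stdGaussian (E := EuclideanSpace ℝ (Fin d))]
  refine (tendsto_integral_posteriorLaw hp hp0 hμ₀ hpx hs hσ hm hτ (K := 1)
    (g := fun t z => (σ t / s t)⁻¹ • (z - (s t)⁻¹ • x t)) (fun t => by fun_prop) ?_
    fun u => ?_).congr' ?_
  · filter_upwards [hu] with t ht u
    rw [ht]
    nlinarith [sq_nonneg (‖u‖ - 1)]
  · exact tendsto_const_nhds.congr' (hu.mono fun t ht => (ht u).symm)
  · filter_upwards [hs, hσ] with t h1 h2
    have hint : Integrable (fun z => z) (posteriorLaw μ₀ (s t) (σ t) (x t)) :=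
      (memLp_id_posteriorLaw μ₀ h1.ne' h2.ne' (x t)).integrable one_le_two
    rw [integral_smul, integral_sub hint (integrable_const _), integral_const]
    simp [posteriorMean]

lemma tendsto_posteriorMean (hp : Continuous p) (hp0 : ∀ z, 0 ≤ p z)
    (hμ₀ : μ₀ = volume.withDensity fun z => ENNReal.ofReal (p z)) (hpx : 0 < p xstar)
    (hs : ∀ᶠ t in l, 0 < s t) (hσ : ∀ᶠ t in l, 0 < σ t)
    (hm : Tendsto (fun t => (s t)⁻¹ • x t) l (𝓝 xstar))
    (hτ : Tendsto (fun t => σ t / s t) l (𝓝 0)) :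
    Tendsto (fun t => posteriorMean μ₀ (s t) (σ t) (x t)) l (𝓝 xstar) := by
  have h := hm.add (hτ.smul (tendsto_posteriorMean_sub hp hp0 hμ₀ hpx hs hσ hm hτ))
  rw [smul_zero, add_zero] at h
  refine h.congr' ?_
  filter_upwards [hs, hσ] with t h1 h2
  rw [smul_inv_smul₀ (div_pos h2 h1).ne', add_sub_cancel]

lemma integral_coord_mul_coord_stdGaussian (i j : Fin d) :
    ∫ u, u i * u j ∂(stdGaussian (EuclideanSpace ℝ (Fin d))) =
      (1 : Matrix (Fin d) (Fin d) ℝ) i j := by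
  have h0 : ∀ k : Fin d, ∫ u, u k ∂(stdGaussian (EuclideanSpace ℝ (Fin d))) = 0 := fun k =>
    integral_strongDual_stdGaussian (EuclideanSpace.proj (𝕜 := ℝ) k)
  rw [← covariance_eval_multivariateGaussian (μ := 0) Matrix.PosSemidef.one i j,
    multivariateGaussian_zero_one, covariance]
  simp [h0]

/-- The posterior covariance is `(σ / s)² (1 + o(1))`. -/
lemma tendsto_posteriorCov (hp : Continuous p) (hp0 : ∀ z, 0 ≤ p z)
    (hμ₀ : μ₀ = volume.withDensity fun z => ENNReal.ofReal (p z)) (hpx : 0 < p xstar)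
    (hs : ∀ᶠ t in l, 0 < s t) (hσ : ∀ᶠ t in l, 0 < σ t)
    (hm : Tendsto (fun t => (s t)⁻¹ • x t) l (𝓝 xstar))
    (hτ : Tendsto (fun t => σ t / s t) l (𝓝 0)) :
    Tendsto (fun t => ((σ t / s t) ^ 2)⁻¹ • posteriorCov μ₀ (s t) (σ t) (x t)) l (𝓝 1) := by
  refine tendsto_pi_nhds.2 fun i => tendsto_pi_nhds.2 fun j => ?_
  have hmean := tendsto_posteriorMean_sub hp hp0 hμ₀ hpx hs hσ hm hτ
  set a : ι → EuclideanSpace ℝ (Fin d) := fun t =>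
    (σ t / s t)⁻¹ • (posteriorMean μ₀ (s t) (σ t) (x t) - (s t)⁻¹ • x t) with ha
  have hu : ∀ᶠ t in l, ∀ u : EuclideanSpace ℝ (Fin d), ∀ k,
      (σ t / s t)⁻¹ * ((((s t)⁻¹ • x t + (σ t / s t) • u) k) -
        posteriorMean μ₀ (s t) (σ t) (x t) k) = (u - a t) k := by
    filter_upwards [hs, hσ] with t h1 h2 u k
    have h3 := (div_pos h2 h1).ne'
    simp only [ha, PiLp.add_apply, PiLp.sub_apply, PiLp.smul_apply, smul_eq_mul]
    field_simp
    ring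
  -- centring at the exact posterior mean makes the integrand `(u - a t) i * (u - a t) j`
  rw [← integral_coord_mul_coord_stdGaussian]
  refine (tendsto_integral_posteriorLaw hp hp0 hμ₀ hpx hs hσ hm hτ (K := 2)
    (g := fun t z => ((σ t / s t)⁻¹ * (z i - posteriorMean μ₀ (s t) (σ t) (x t) i)) *
      ((σ t / s t)⁻¹ * (z j - posteriorMean μ₀ (s t) (σ t) (x t) j)))
    (f := fun u => u i * u j) (fun t => by fun_prop) ?_ fun u => ?_).congr' ?_
  · have ha1 : ∀ᶠ t in l, ‖a t‖ ≤ 1 :=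
      hmean.norm.eventually (ge_mem_nhds (by simp))
    filter_upwards [hu, ha1] with t ht hat u
    have h1 : ∀ k, ‖(u - a t) k‖ ≤ ‖u‖ + 1 := fun k =>
      (PiLp.norm_apply_le _ k).trans ((norm_sub_le _ _).trans (by gcongr))
    rw [ht, ht, norm_mul]
    calc _ ≤ (‖u‖ + 1) * (‖u‖ + 1) := by gcongr <;> exact h1 _
      _ ≤ _ := by nlinarith [sq_nonneg (‖u‖ - 1)]
  · have h1 : Tendsto (fun t => u - a t) l (𝓝 u) := by
      simpa using (tendsto_const_nhds (x := u)).sub hmean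
    have h2 : ∀ k, Tendsto (fun t => (u - a t) k) l (𝓝 (u k)) := fun k =>
      ((EuclideanSpace.proj (𝕜 := ℝ) k).continuous.tendsto u).comp h1
    exact ((h2 i).mul (h2 j)).congr' (hu.mono fun t ht => by simp only [ht])
  · filter_upwards [hs, hσ] with t h1 h2
    have hint : ∀ k, Integrable (fun z : EuclideanSpace ℝ (Fin d) => z k)
        (posteriorLaw μ₀ (s t) (σ t) (x t)) := fun k =>
      ((EuclideanSpace.proj (𝕜 := ℝ) k).integrable_comp
        ((memLp_id_posteriorLaw μ₀ h1.ne' h2.ne' (x t)).integrable one_le_two))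
    have hmk : ∀ k, posteriorMean μ₀ (s t) (σ t) (x t) k =
        ∫ z, z k ∂(posteriorLaw μ₀ (s t) (σ t) (x t)) := eval_integral_piLp hint
    simp only [Matrix.smul_apply, posteriorCov, Matrix.of_apply, covariance, smul_eq_mul, ← hmk]
    rw [← integral_const_mul]
    congr 1
    ext z
    ring

lemma posSemidef_posteriorCov {s σ : ℝ} (hs : s ≠ 0) (hσ : σ ≠ 0)
    (x : EuclideanSpace ℝ (Fin d)) : (posteriorCov μ₀ s σ x).PosSemidef := by
  have hL : ∀ i, MemLp (fun z : EuclideanSpace ℝ (Fin d) => z i) 2 (posteriorLaw μ₀ s σ x) :=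
    fun i => (EuclideanSpace.proj (𝕜 := ℝ) i).comp_memLp' (memLp_id_posteriorLaw μ₀ hs hσ x)
  refine Matrix.PosSemidef.of_dotProduct_mulVec_nonneg ?_ fun v => ?_
  · ext i j
    exact covariance_comm _ _
  · have h := variance_nonneg (fun z => ∑ i, v i * z i) (posteriorLaw μ₀ s σ x)
    rw [variance_fun_sum fun i => (hL i).const_mul (v i)] at h
    refine h.trans_eq ?_
    simp only [dotProduct, Matrix.mulVec, posteriorCov, Matrix.of_apply, Finset.mul_sum,
      covariance_const_mul_left, covariance_const_mul_right, star_trivial]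
    refine Finset.sum_congr rfl fun i _ => Finset.sum_congr rfl fun j _ => ?_
    ring

end Posterior

/-! ### The linearized constraint -/

section Gradient

variable {d r : ℕ} {C : EuclideanSpace ℝ (Fin d) → EuclideanSpace ℝ (Fin r)}

lemma toEuclideanLin_transpose_gradMatrix (x v : EuclideanSpace ℝ (Fin d)) :
    Matrix.toEuclideanLin (gradMatrix C x)ᵀ v = fderiv ℝ C x v := by
  conv_rhs => rw [← (EuclideanSpace.basisFun (Fin d) ℝ).sum_repr v]
  ext j
  simp [gradMatrix, Matrix.toLpLin_apply, Matrix.mulVec, dotProduct, mul_comm]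

lemma continuous_gradMatrix (hC : ContDiff ℝ 1 C) : Continuous (gradMatrix C) := by
  have h := hC.continuous_fderiv one_ne_zero
  refine continuous_pi fun i => continuous_pi fun j => ?_
  exact (EuclideanSpace.proj (𝕜 := ℝ) j).continuous.comp (h.clm_apply continuous_const)

lemma posDef_transpose_gradMatrix_mul {x : EuclideanSpace ℝ (Fin d)}
    (hx : Function.Surjective (fderiv ℝ C x)) :
    ((gradMatrix C x)ᵀ * gradMatrix C x).PosDef := by
  have hinj : Function.Injective (gradMatrix C x).mulVec := by
    have hsurj : Function.Surjective (gradMatrix C x)ᵀ.mulVec := fun y => by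
      obtain ⟨v, hv⟩ := hx (WithLp.toLp 2 y)
      rw [← toEuclideanLin_transpose_gradMatrix] at hv
      exact ⟨v.ofLp, congrArg WithLp.ofLp hv⟩
    refine (injective_iff_map_eq_zero (gradMatrix C x).mulVecLin).2 fun w hw => ?_
    obtain ⟨y, hy⟩ := hsurj w
    refine dotProduct_self_eq_zero.1 ?_
    nth_rw 2 [← hy]
    rw [Matrix.dotProduct_mulVec, Matrix.vecMul_transpose, ← Matrix.mulVecLin_apply, hw,
      zero_dotProduct]
  simpa using Matrix.PosDef.conjTranspose_mul_self (gradMatrix C x) hinj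

/-- Difference quotients at scale `τ` along two moving points. Strict differentiability is needed
because neither point is the base point `x`. -/
lemma HasStrictFDerivAt.tendsto_inv_smul_sub {ι E F : Type*} [NormedAddCommGroup E]
    [NormedSpace ℝ E] [NormedAddCommGroup F] [NormedSpace ℝ F] {f : E → F} {f' : E →L[ℝ] F}
    {x : E} (hf : HasStrictFDerivAt f f' x) {l : Filter ι} {τ : ι → ℝ} {y z : ι → E} {v : E}
    (hy : Tendsto y l (𝓝 x)) (hz : Tendsto z l (𝓝 x))
    (hv : Tendsto (fun t => (τ t)⁻¹ • (y t - z t)) l (𝓝 v)) :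
    Tendsto (fun t => (τ t)⁻¹ • (f (y t) - f (z t))) l (𝓝 (f' v)) := by
  have h1 := hf.isLittleO.comp_tendsto (hy.prodMk_nhds hz)
  have h2 := ((Asymptotics.isBigO_refl (fun t => (τ t)⁻¹) l).smul_isLittleO h1).trans_isBigO
    (hv.isBigO_one ℝ)
  have h3 := (Asymptotics.isLittleO_one_iff ℝ).1 h2
  have h4 := h3.add ((f'.continuous.tendsto v).comp hv)
  rw [zero_add] at h4
  refine h4.congr fun t => ?_
  change (τ t)⁻¹ • (f (y t) - f (z t) - f' (y t - z t)) + f' ((τ t)⁻¹ • (y t - z t)) = _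
  rw [map_smul, ← smul_add, sub_add_cancel]

lemma continuous_standardizedResidual (hC : Continuous C)
    (μ₀ : Measure (EuclideanSpace ℝ (Fin d))) (s σ : ℝ) (x : EuclideanSpace ℝ (Fin d)) :
    Continuous (standardizedResidual μ₀ C s σ x) :=
  (LinearMap.continuous_of_finiteDimensional _).comp (hC.sub continuous_const)

end Gradient

section Limit

variable {d r : ℕ} {p : EuclideanSpace ℝ (Fin d) → ℝ} {μ₀ : Measure (EuclideanSpace ℝ (Fin d))}
  [IsProbabilityMeasure μ₀] {C : EuclideanSpace ℝ (Fin d) → EuclideanSpace ℝ (Fin r)}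
  {ι : Type*} {l : Filter ι} [l.IsCountablyGenerated] {s σ : ι → ℝ}
  {x : ι → EuclideanSpace ℝ (Fin d)} {xstar : EuclideanSpace ℝ (Fin d)}

/-- After division by `(σ / s)²`, the linearized covariance converges to the Gram matrix of the
gradient at the limit point. -/
lemma tendsto_linearizedCov (hp : Continuous p) (hp0 : ∀ z, 0 ≤ p z)
    (hμ₀ : μ₀ = volume.withDensity fun z => ENNReal.ofReal (p z)) (hpx : 0 < p xstar)
    (hs : ∀ᶠ t in l, 0 < s t) (hσ : ∀ᶠ t in l, 0 < σ t)
    (hm : Tendsto (fun t => (s t)⁻¹ • x t) l (𝓝 xstar))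
    (hτ : Tendsto (fun t => σ t / s t) l (𝓝 0)) (hC : ContDiff ℝ 1 C) :
    Tendsto (fun t => ((σ t / s t) ^ 2)⁻¹ • linearizedCov μ₀ C (s t) (σ t) (x t)) l
      (𝓝 ((gradMatrix C xstar)ᵀ * gradMatrix C xstar)) := by
  have hG := ((continuous_gradMatrix hC).tendsto xstar).comp
    (tendsto_posteriorMean hp hp0 hμ₀ hpx hs hσ hm hτ)
  have hS := tendsto_posteriorCov hp hp0 hμ₀ hpx hs hσ hm hτ
  have hcont : Continuous fun q : Matrix (Fin d) (Fin r) ℝ × Matrix (Fin d) (Fin d) ℝ =>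
      q.1ᵀ * q.2 * q.1 :=
    (continuous_fst.matrix_transpose.matrix_mul continuous_snd).matrix_mul continuous_fst
  have h := (hcont.tendsto _).comp (hG.prodMk_nhds hS)
  rw [Matrix.mul_one] at h
  refine h.congr fun t => ?_
  simp [linearizedCov]

lemma posSemidef_linearizedCov {s σ : ℝ} (hs : s ≠ 0) (hσ : σ ≠ 0)
    (x : EuclideanSpace ℝ (Fin d)) : (linearizedCov μ₀ C s σ x).PosSemidef :=
  (posSemidef_posteriorCov hs hσ x).conjTranspose_mul_mul_same _

/-- The rescaled linearized covariance is positive semidefinite, and its determinant has a positive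
limit. -/
lemma eventually_posDef_smul_linearizedCov (hp : Continuous p) (hp0 : ∀ z, 0 ≤ p z)
    (hμ₀ : μ₀ = volume.withDensity fun z => ENNReal.ofReal (p z)) (hpx : 0 < p xstar)
    (hs : ∀ᶠ t in l, 0 < s t) (hσ : ∀ᶠ t in l, 0 < σ t)
    (hm : Tendsto (fun t => (s t)⁻¹ • x t) l (𝓝 xstar))
    (hτ : Tendsto (fun t => σ t / s t) l (𝓝 0)) (hC : ContDiff ℝ 1 C)
    (hx : Function.Surjective (fderiv ℝ C xstar)) :
    ∀ᶠ t in l, (((σ t / s t) ^ 2)⁻¹ • linearizedCov μ₀ C (s t) (σ t) (x t)).PosDef := by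
  have hdet := ((continuous_id.matrix_det).tendsto _).comp
    (tendsto_linearizedCov hp hp0 hμ₀ hpx hs hσ hm hτ hC)
  have hne := hdet.eventually_ne (posDef_transpose_gradMatrix_mul hx).det_pos.ne'
  filter_upwards [hs, hσ, hne] with t h1 h2 h3
  have hpsd := (posSemidef_linearizedCov (μ₀ := μ₀) (C := C) h1.ne' h2.ne' (x t)).smul
    (inv_nonneg.2 (sq_nonneg (σ t / s t)))
  exact hpsd.posDef_iff_det_ne_zero.2 h3

/-- In the coordinate `u` given by `z = s⁻¹ x + (σ / s) u`, the standardized residual converges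
to the linear map `(∇Cᵀ ∇C) ^ (-1/2) ∇Cᵀ` at the limit point. -/
lemma tendsto_standardizedResidual (hp : Continuous p) (hp0 : ∀ z, 0 ≤ p z)
    (hμ₀ : μ₀ = volume.withDensity fun z => ENNReal.ofReal (p z)) (hpx : 0 < p xstar)
    (hs : ∀ᶠ t in l, 0 < s t) (hσ : ∀ᶠ t in l, 0 < σ t)
    (hm : Tendsto (fun t => (s t)⁻¹ • x t) l (𝓝 xstar))
    (hτ : Tendsto (fun t => σ t / s t) l (𝓝 0)) (hC : ContDiff ℝ 1 C)
    (hx : Function.Surjective (fderiv ℝ C xstar)) (u : EuclideanSpace ℝ (Fin d)) :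
    Tendsto (fun t => standardizedResidual μ₀ C (s t) (σ t) (x t)
        ((s t)⁻¹ • x t + (σ t / s t) • u)) l
      (𝓝 (Matrix.toEuclideanLin (invSqrt ((gradMatrix C xstar)ᵀ * gradMatrix C xstar) *
        (gradMatrix C xstar)ᵀ) u)) := by
  set A := fun t => ((σ t / s t) ^ 2)⁻¹ • linearizedCov μ₀ C (s t) (σ t) (x t) with hA
  have hAlim : Tendsto A l _ := tendsto_linearizedCov hp hp0 hμ₀ hpx hs hσ hm hτ hC
  have hApos : ∀ᶠ t in l, (A t).PosDef :=
    eventually_posDef_smul_linearizedCov hp hp0 hμ₀ hpx hs hσ hm hτ hC hx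
  have hsqrt : Tendsto (fun t => invSqrt (A t)) l
      (𝓝 (invSqrt ((gradMatrix C xstar)ᵀ * gradMatrix C xstar))) :=
    (continuousOn_invSqrt _ (posDef_transpose_gradMatrix_mul hx)).tendsto.comp
      (tendsto_nhdsWithin_iff.2 ⟨hAlim, hApos⟩)
  have hmean := tendsto_posteriorMean_sub hp hp0 hμ₀ hpx hs hσ hm hτ
  have hquot : Tendsto (fun t => (σ t / s t)⁻¹ • (C ((s t)⁻¹ • x t + (σ t / s t) • u) -
      C (posteriorMean μ₀ (s t) (σ t) (x t)))) l (𝓝 (fderiv ℝ C xstar u)) := by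
    refine (hC.contDiffAt.hasStrictFDerivAt one_ne_zero).tendsto_inv_smul_sub ?_
      (tendsto_posteriorMean hp hp0 hμ₀ hpx hs hσ hm hτ) ?_
    · simpa using hm.add (hτ.smul_const u)
    · have h : Tendsto (fun t => u - (σ t / s t)⁻¹ •
          (posteriorMean μ₀ (s t) (σ t) (x t) - (s t)⁻¹ • x t)) l (𝓝 u) := by
        simpa using (tendsto_const_nhds (x := u)).sub hmean
      refine h.congr' ?_
      filter_upwards [hs, hσ] with t h1 h2
      rw [add_sub_right_comm, smul_add, inv_smul_smul₀ (div_pos h2 h1).ne', add_comm,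
        sub_eq_add_neg, ← smul_neg, neg_sub]
  have hcont : Continuous fun q : Matrix (Fin r) (Fin r) ℝ × EuclideanSpace ℝ (Fin r) =>
      Matrix.toEuclideanLin q.1 q.2 :=
    (PiLp.continuous_toLp 2 _).comp
      (continuous_fst.matrix_mulVec ((PiLp.continuous_ofLp 2 _).comp continuous_snd))
  have h := (hcont.tendsto _).comp (hsqrt.prodMk_nhds hquot)
  have hlim : Matrix.toEuclideanLin (invSqrt ((gradMatrix C xstar)ᵀ * gradMatrix C xstar) *
      (gradMatrix C xstar)ᵀ) u =
      Matrix.toEuclideanLin (invSqrt ((gradMatrix C xstar)ᵀ * gradMatrix C xstar))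
        (fderiv ℝ C xstar u) := by
    rw [← toEuclideanLin_transpose_gradMatrix]
    simp [Matrix.toLpLin_apply, Matrix.mulVec_mulVec]
  rw [hlim]
  refine h.congr' ?_
  filter_upwards [hs, hσ] with t h1 h2
  have hτt := div_pos h2 h1
  have hherm : (linearizedCov μ₀ C (s t) (σ t) (x t)).IsHermitian :=
    (posSemidef_linearizedCov h1.ne' h2.ne' (x t)).isHermitian
  -- the factor `(σ / s)⁻¹` of the difference quotient is the one by which `invSqrt` scales
  simp only [Function.comp_apply, standardizedResidual, hA]
  rw [invSqrt_smul hherm (by positivity), Real.sqrt_inv, Real.sqrt_sq hτt.le, inv_inv]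
  simp only [map_smul, LinearMap.smul_apply, inv_smul_smul₀ hτt.ne']

/-- The limiting linear map `(Jᵀ J) ^ (-1/2) Jᵀ` has orthonormal rows, so it preserves the standard
Gaussian law. -/
lemma stdGaussian_map_invSqrt_mul {J : Matrix (Fin d) (Fin r) ℝ} (hJ : (Jᵀ * J).PosDef) :
    (stdGaussian (EuclideanSpace ℝ (Fin d))).map
      (Matrix.toEuclideanLin (invSqrt (Jᵀ * J) * Jᵀ)) =
    stdGaussian (EuclideanSpace ℝ (Fin r)) := by
  refine stdGaussian_map_of_comp_adjoint_eq_id _ ?_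
  rw [← Matrix.toEuclideanLin_conjTranspose_eq_adjoint]
  have h : invSqrt (Jᵀ * J) * Jᵀ * (invSqrt (Jᵀ * J) * Jᵀ)ᴴ = 1 := by
    rw [Matrix.conjTranspose_mul, isHermitian_invSqrt.eq, ← invSqrt_mul_self_mul_invSqrt hJ]
    simp [Matrix.mul_assoc]
  refine LinearMap.ext fun v => ?_
  have := congrArg (fun M => Matrix.toEuclideanLin M v) h
  simpa [Matrix.toLpLin_apply, Matrix.mulVec_mulVec] using this

lemma tendstoInDistribution_standardizedResidual (hp : Continuous p) (hp0 : ∀ z, 0 ≤ p z)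
    (hμ₀ : μ₀ = volume.withDensity fun z => ENNReal.ofReal (p z)) (hpx : 0 < p xstar)
    (hs : ∀ᶠ t in l, 0 < s t) (hσ : ∀ᶠ t in l, 0 < σ t)
    (hm : Tendsto (fun t => (s t)⁻¹ • x t) l (𝓝 xstar))
    (hτ : Tendsto (fun t => σ t / s t) l (𝓝 0)) (hC : ContDiff ℝ 1 C)
    (hx : Function.Surjective (fderiv ℝ C xstar)) :
    TendstoInDistribution (fun t z => standardizedResidual μ₀ C (s t) (σ t) (x t) z) l id
      (fun t => posteriorLaw μ₀ (s t) (σ t) (x t)) (stdGaussian (EuclideanSpace ℝ (Fin r))) := by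
  have hRc : ∀ t, Continuous (standardizedResidual μ₀ C (s t) (σ t) (x t)) := fun t =>
    continuous_standardizedResidual hC.continuous _ _ _ _
  refine ⟨fun t => (hRc t).aemeasurable, aemeasurable_id,
    ProbabilityMeasure.tendsto_iff_forall_integral_tendsto.2 fun f => ?_⟩
  set L := Matrix.toEuclideanLin (invSqrt ((gradMatrix C xstar)ᵀ * gradMatrix C xstar) *
    (gradMatrix C xstar)ᵀ)
  have hL : Continuous L := L.continuous_of_finiteDimensional
  have h := tendsto_integral_posteriorLaw hp hp0 hμ₀ hpx hs hσ hm hτ (K := ‖f‖)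
    (g := fun t z => f (standardizedResidual μ₀ C (s t) (σ t) (x t) z)) (f := fun u => f (L u))
    (fun t => f.continuous.comp (hRc t))
    (Eventually.of_forall fun t u => (f.norm_coe_le_norm _).trans
      (le_mul_of_one_le_right (norm_nonneg _) (by nlinarith [sq_nonneg ‖u‖])))
    (fun u => (f.continuous.tendsto _).comp
      (tendsto_standardizedResidual hp hp0 hμ₀ hpx hs hσ hm hτ hC hx u))
  simp only [ProbabilityMeasure.coe_mk, Measure.map_id]
  rw [← stdGaussian_map_invSqrt_mul (posDef_transpose_gradMatrix_mul hx),
    integral_map hL.aemeasurable f.continuous.aestronglyMeasurable]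
  refine h.congr fun t => ?_
  rw [integral_map (hRc t).aemeasurable f.continuous.aestronglyMeasurable]

end Limit

/-! ### Convergence in the zero-noise limit -/

theorem mainTheorem2 {d r : ℕ} {Ω : Type*} [MeasurableSpace Ω]
    (P : Measure Ω) [IsProbabilityMeasure P]
    -- the data distribution, with a smooth density `p`
    (p : EuclideanSpace ℝ (Fin d) → ℝ) (hp_smooth : ContDiff ℝ ∞ p) (hp_nonneg : ∀ z, 0 ≤ p z)
    (μ₀ : Measure (EuclideanSpace ℝ (Fin d))) [IsProbabilityMeasure μ₀]
    (hμ₀ : μ₀ = volume.withDensity fun z => ENNReal.ofReal (p z))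
    -- the noise schedule
    (s σ : ℝ → ℝ) (hs_pos : ∀ t ∈ Set.Ioc (0 : ℝ) 1, 0 < s t)
    (hσ_pos : ∀ t ∈ Set.Ioc (0 : ℝ) 1, 0 < σ t)
    (s₀ : ℝ) (hs₀ : 0 < s₀) (hs : Tendsto s (𝓝[>] 0) (𝓝 s₀)) (hσ : Tendsto σ (𝓝[>] 0) (𝓝 0))
    -- the noised data `X t = s t • X₀ + σ t • ε t`
    (X₀ : Ω → EuclideanSpace ℝ (Fin d)) (hX₀ : HasLaw X₀ μ₀ P)
    (ε X : ℝ → Ω → EuclideanSpace ℝ (Fin d))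
    (hε : ∀ t ∈ Set.Ioc (0 : ℝ) 1, HasLaw (ε t) (stdGaussian (EuclideanSpace ℝ (Fin d))) P)
    (hindep : ∀ t ∈ Set.Ioc (0 : ℝ) 1, IndepFun X₀ (ε t) P)
    (hX : ∀ t ∈ Set.Ioc (0 : ℝ) 1, ∀ w, X t w = s t • X₀ w + σ t • ε t w)
    -- the constraint
    (C : EuclideanSpace ℝ (Fin d) → EuclideanSpace ℝ (Fin r)) (hC : AnalyticOnNhd ℝ C Set.univ) :
    -- `posteriorLaw` is the conditional law of `X₀` given `X t`
    (∀ t ∈ Set.Ioc (0 : ℝ) 1,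
      ∀ᵐ y ∂(P.map (X t)), condDistrib X₀ (X t) P y = posteriorLaw μ₀ (s t) (σ t) y) ∧
    -- it has finite second moments
    (∀ t ∈ Set.Ioc (0 : ℝ) 1, ∀ y, MemLp id 2 (posteriorLaw μ₀ (s t) (σ t) y)) ∧
    -- convergence along all values `x t` of `X t` tending to the noiseless value
    ∀ (x : ℝ → EuclideanSpace ℝ (Fin d)) (xstar : EuclideanSpace ℝ (Fin d)),
      Tendsto x (𝓝[>] 0) (𝓝 (s₀ • xstar)) → 0 < p xstar →
      Function.Surjective (fderiv ℝ C xstar) →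
      (∀ᶠ t in 𝓝[>] (0 : ℝ), (linearizedCov μ₀ C (s t) (σ t) (x t)).PosDef) ∧
      TendstoInDistribution
        (fun t z => standardizedResidual μ₀ C (s t) (σ t) (x t) z) (𝓝[>] (0 : ℝ)) id
        (fun t => posteriorLaw μ₀ (s t) (σ t) (x t))
        (stdGaussian (EuclideanSpace ℝ (Fin r))) := by
  have hpc := hp_smooth.continuous
  have hIoc : ∀ᶠ t in 𝓝[>] (0 : ℝ), t ∈ Set.Ioc (0 : ℝ) 1 := Ioc_mem_nhdsGT one_pos
  have hs' : ∀ᶠ t in 𝓝[>] (0 : ℝ), 0 < s t := hIoc.mono hs_pos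
  have hσ' : ∀ᶠ t in 𝓝[>] (0 : ℝ), 0 < σ t := hIoc.mono hσ_pos
  have hτ : Tendsto (fun t => σ t / s t) (𝓝[>] 0) (𝓝 0) := by
    have h := hσ.div hs hs₀.ne'
    rwa [zero_div] at h
  have hC1 : ContDiff ℝ 1 C := contDiffOn_univ.1 (hC.contDiffOn uniqueDiffOn_univ)
  refine ⟨fun t ht => condDistrib_ae_eq_posteriorLaw μ₀ (hσ_pos t ht).ne' hX₀ (hε t ht)
    (hindep t ht) (hX t ht), fun t ht y => memLp_id_posteriorLaw μ₀ (hs_pos t ht).ne'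
    (hσ_pos t ht).ne' y, fun x xstar hx hpx hsurj => ?_⟩
  have hm : Tendsto (fun t => (s t)⁻¹ • x t) (𝓝[>] 0) (𝓝 xstar) := by
    simpa [smul_smul, inv_mul_cancel₀ hs₀.ne'] using (hs.inv₀ hs₀.ne').smul hx
  refine ⟨?_, tendstoInDistribution_standardizedResidual hpc hp_nonneg hμ₀ hpx hs' hσ' hm hτ hC1
    hsurj⟩
  filter_upwards [hs', hσ', eventually_posDef_smul_linearizedCov hpc hp_nonneg hμ₀ hpx hs' hσ' hm
    hτ hC1 hsurj] with t h1 h2 h3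
  have hτt := pow_pos (div_pos h2 h1) 2
  simpa only [smul_inv_smul₀ hτt.ne'] using h3.smul hτt
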